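/- Let $\tau(n)$ denote Ramanujan's tau function, defined by $$\Delta(z)=q\prod_{m\ge 1}(1-q^m)^{24}=\sum_{n\ge 1}\tau(n)q^n,\qquad q=e^{2\pi i z},\ \operatorname{Im} z>0,$$ and let $\sigma_k(n)=\sum_{d\mid n}d^k$. Then for every integer $n\ge 1$ the following five identities hold: (i) $$\tau(n)=\frac{5}{12}n\sigma_3(n)+\frac{7}{12}n\sigma_5(n)+70\sum_{m=1}^{n-1}(2n-5m)\sigma_3(m)\sigma_5(n-m);$$ (ii) $$\tau(n)=n^2\sigma_3(n)+60\sum_{m=1}^{n-1}(4n^2-13mn+9m^2)\sigma_3(m)\sigma_3(n-m);$$ (iii) $$\tau(n)=\frac{65}{756}\sigma_{11}(n)+\frac{5\cdot 691}{12\cdot 756\,n}\sigma_7(n)+\frac{691}{12\cdot 108\,n}\sigma_5(n)-\frac{5\cdot 691}{54n^2}\sum_{m=1}^{n-1}(3n-7m)\sigma_5(m)\sigma_7(n-m)-\frac{13\cdot 691}{9n^2}\sum_{m=1}^{n-1}m(n-m)\sigma_5(m)\sigma_5(n-m);$$ (iv) $$\tau(n)=\frac{65}{756}\sigma_{11}(n)+\frac{3\cdot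 691}{8\cdot 441}\sigma_3(n)+\frac{5\cdot 691}{24\cdot 441}\sigma_7(n)+\frac{5\cdot 691}{441n^2}\sum_{m=1}^{n-1}(91m^2-65mn+10n^2)\sigma_3(m)\sigma_7(n-m)-\frac{13\cdot 691}{9n^2}\sum_{m=1}^{n-1}m(n-m)\sigma_5(m)\sigma_5(n-m);$$ (v) $$\tau(n)=\frac{65}{756}\sigma_{11}(n)+\frac{25\cdot 691}{36\cdot 756\,n}\sigma_3(n)+\frac{11\cdot 691}{36\cdot 756\,n}\sigma_9(n)-\frac{55\cdot 691}{1134n^2}\sum_{m=1}^{n-1}(7m-2n)\sigma_3(m)\sigma_9(n-m)-\frac{13\cdot 691}{9n^2}\sum_{m=1}^{n-1}m(n-m)\sigma_5(m)\sigma_5(n-m).$$ -/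

import Mathlib

/-- Ramanujan's tau function `τ(n)`: the `n`-th Fourier coefficient of the discriminant cusp form
`Δ(z) = q ∏_{m ≥ 1} (1 - q ^ m) ^ 24 = ∑ τ(n) q ^ n`, where `q = e ^ (2πiz)` and `z` is in the upper
half-plane. The values are integers; they are regarded here as complex numbers. -/
noncomputable def ramanujanTau (n : ℕ) : ℂ :=
  (UpperHalfPlane.qExpansion 1 ModularForm.discriminant).coeff n

/-- The defining expansion `q ∏_{m ≥ 1} (1 - q ^ m) ^ 24 = ∑ τ(n) q ^ n`. -/
theorem hasSum_ramanujanTau (z : UpperHalfPlane) :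
    HasSum (fun n : ℕ => ramanujanTau n * Complex.exp (2 * Real.pi * Complex.I * z) ^ n)
      (Complex.exp (2 * Real.pi * Complex.I * z) *
        ∏' m : ℕ, (1 - Complex.exp (2 * Real.pi * Complex.I * z) ^ (m + 1)) ^ 24) := by
  have hq : Function.Periodic.qParam 1 (z : ℂ) = Complex.exp (2 * Real.pi * Complex.I * z) := by
    simp [Function.Periodic.qParam]
  have h := ModularForm.hasSum_qExpansion (f := CuspForm.discriminant) one_pos
    one_mem_strictPeriods_SL z
  have hz : CuspForm.discriminant z = Function.Periodic.qParam 1 (z : ℂ) *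
      ∏' m : ℕ, (1 - Function.Periodic.qParam 1 (z : ℂ) ^ (m + 1)) ^ 24 :=
    ModularForm.discriminant_eq_q_prod z
  rw [hz, hq] at h
  exact h

/-- The convolution sum `∑_{m=1}^{n-1} w(m) σ_a(m) σ_b(n-m)` with weight `w`, where
`σ_k(n) = ∑_{d ∣ n} d ^ k`. -/
noncomputable def sigmaConv (a b : ℕ) (w : ℕ → ℂ) (n : ℕ) : ℂ :=
  ∑ m ∈ Finset.Ico 1 n,
    w m * (ArithmeticFunction.sigma a m : ℂ) * (ArithmeticFunction.sigma b (n - m) : ℂ)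

/-! ### Polynomial identities in a ring with Ramanujan's derivation -/

section RamanujanDerivation

variable {A : Type*} [CommRing A] [Algebra ℂ A] (D : Derivation ℂ A A) {P Q R t : A}

/-! With `θ = X d/dX`, Ramanujan's equations make the polynomials in `P = E₂`, `Q = E₄`, `R = E₆`
stable under `θ`. The series of `τ` and of `σ₃, σ₅, σ₇, σ₉, σ₁₁` are polynomials in `Q`, `R`, and a
convolution with polynomial weight in `m` and `n - m` is a coefficient of products of
`θ`-derivatives. Each claim is thus the `n`-th coefficient of a polynomial identity in `P, Q, R`,
checked by normalization.

The weights are Rankin–Cohen brackets. The first bracket of `(E₄, E₆)` and the second of `(E₄, E₄)`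
are cusp forms of weight 12, hence multiples of `Δ`: this gives (i) and (ii). The constant terms of
the Eisenstein series produce the unconvolved `σ` terms.

In (iii)–(v), multiplied by `n²`, the factor `65/756` cancels `Q³`, so `τ - (65/756) σ₁₁` has series
`-(691/762048)(R² - 1)`. Up to a multiple of `(θ R)²`, which is the `σ₅, σ₅` convolution, `θ²(R²)`
is a multiple of the weight 16 cusp form `Δ E₄`. The three formulas express that form through
brackets of `(E₆, E₈)`, `(E₄, E₈)` and `(E₄, E₁₀)`. -/

lemma derivation_identity_three_five
    (hQ : D Q = (3⁻¹ : ℂ) • (P * Q - R)) (hR : D R = (2⁻¹ : ℂ) • (P * R - Q * Q))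
    (ht : t = (1728⁻¹ : ℂ) • (Q ^ 3 - R ^ 2)) {s₃ s₅ : A}
    (h₃ : s₃ = (240⁻¹ : ℂ) • (Q - 1))
    (h₅ : s₅ = (504⁻¹ : ℂ) • (1 - R)) :
    t = (5 / 12 : ℂ) • D s₃ + (7 / 12 : ℂ) • D s₅ +
      (70 : ℂ) • ((-3 : ℂ) • (D s₃ * s₅) + (2 : ℂ) • (s₃ * D s₅)) := by
  subst ht h₃ h₅
  simp only [Derivation.map_smul, Derivation.map_sub, Derivation.map_one_eq_zero, hQ, hR]
  algebra

/-- Both factors agree, so the outer terms of the bracket merge; the zero coefficient keeps the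
three-term shape of `sigmaConv_quadratic`. -/
lemma derivation_identity_three_three
    (hP : D P = (12⁻¹ : ℂ) • (P * P - Q))
    (hQ : D Q = (3⁻¹ : ℂ) • (P * Q - R)) (hR : D R = (2⁻¹ : ℂ) • (P * R - Q * Q))
    (ht : t = (1728⁻¹ : ℂ) • (Q ^ 3 - R ^ 2)) {s₃ : A}
    (h₃ : s₃ = (240⁻¹ : ℂ) • (Q - 1)) :
    t = D (D s₃) + (60 : ℂ) • ((0 : ℂ) • (D (D s₃) * s₃) +
      (-5 : ℂ) • (D s₃ * D s₃) + (4 : ℂ) • (s₃ * D (D s₃))) := by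
  subst ht h₃
  simp only [Derivation.map_smul, Derivation.map_sub, Derivation.map_one_eq_zero,
    Derivation.leibniz, smul_eq_mul, sub_zero, hP, hQ, hR]
  algebra

lemma derivation_identity_five_seven
    (hP : D P = (12⁻¹ : ℂ) • (P * P - Q))
    (hQ : D Q = (3⁻¹ : ℂ) • (P * Q - R)) (hR : D R = (2⁻¹ : ℂ) • (P * R - Q * Q))
    (ht : t = (1728⁻¹ : ℂ) • (Q ^ 3 - R ^ 2)) {s₅ s₇ s₁₁ : A}
    (h₅ : s₅ = (504⁻¹ : ℂ) • (1 - R))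
    (h₇ : s₇ = (480⁻¹ : ℂ) • (Q * Q - 1))
    (h₁₁ : s₁₁ = (65520⁻¹ : ℂ) • ((441 : ℂ) • Q ^ 3 + (250 : ℂ) • R ^ 2 - (691 : ℂ) • 1)) :
    D (D t) = (65 / 756 : ℂ) • D (D s₁₁) + (5 * 691 / (12 * 756) : ℂ) • D s₇ +
      (691 / (12 * 108) : ℂ) • D s₅ -
      (5 * 691 / 54 : ℂ) • ((-4 : ℂ) • (D s₅ * s₇) + (3 : ℂ) • (s₅ * D s₇)) -
      (13 * 691 / 9 : ℂ) • (D s₅ * D s₅) := by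
  subst ht h₅ h₇ h₁₁
  simp only [Derivation.map_smul, Derivation.map_sub, Derivation.map_add,
    Derivation.map_one_eq_zero, Derivation.leibniz, pow_succ, pow_zero, one_mul, smul_eq_mul,
    smul_zero, zero_sub, sub_zero, hP, hQ, hR]
  algebra

lemma derivation_identity_three_seven
    (hP : D P = (12⁻¹ : ℂ) • (P * P - Q))
    (hQ : D Q = (3⁻¹ : ℂ) • (P * Q - R)) (hR : D R = (2⁻¹ : ℂ) • (P * R - Q * Q))
    (ht : t = (1728⁻¹ : ℂ) • (Q ^ 3 - R ^ 2)) {s₃ s₅ s₇ s₁₁ : A}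
    (h₃ : s₃ = (240⁻¹ : ℂ) • (Q - 1))
    (h₅ : s₅ = (504⁻¹ : ℂ) • (1 - R))
    (h₇ : s₇ = (480⁻¹ : ℂ) • (Q * Q - 1))
    (h₁₁ : s₁₁ = (65520⁻¹ : ℂ) • ((441 : ℂ) • Q ^ 3 + (250 : ℂ) • R ^ 2 - (691 : ℂ) • 1)) :
    D (D t) = (65 / 756 : ℂ) • D (D s₁₁) +
      (3 * 691 / (8 * 441) : ℂ) • D (D s₃) + (5 * 691 / (24 * 441) : ℂ) • D (D s₇) +
      (5 * 691 / 441 : ℂ) • ((36 : ℂ) • (D (D s₃) * s₇) + (-45 : ℂ) • (D s₃ * D s₇) +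
        (10 : ℂ) • (s₃ * D (D s₇))) -
      (13 * 691 / 9 : ℂ) • (D s₅ * D s₅) := by
  subst ht h₃ h₅ h₇ h₁₁
  simp only [Derivation.map_smul, Derivation.map_sub, Derivation.map_add,
    Derivation.map_one_eq_zero, Derivation.leibniz, pow_succ, pow_zero, one_mul, smul_eq_mul,
    smul_zero, zero_sub, sub_zero, hP, hQ, hR]
  algebra

lemma derivation_identity_three_nine
    (hP : D P = (12⁻¹ : ℂ) • (P * P - Q))
    (hQ : D Q = (3⁻¹ : ℂ) • (P * Q - R)) (hR : D R = (2⁻¹ : ℂ) • (P * R - Q * Q))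
    (ht : t = (1728⁻¹ : ℂ) • (Q ^ 3 - R ^ 2)) {s₃ s₅ s₉ s₁₁ : A}
    (h₃ : s₃ = (240⁻¹ : ℂ) • (Q - 1))
    (h₅ : s₅ = (504⁻¹ : ℂ) • (1 - R))
    (h₉ : s₉ = (264⁻¹ : ℂ) • (1 - Q * R))
    (h₁₁ : s₁₁ = (65520⁻¹ : ℂ) • ((441 : ℂ) • Q ^ 3 + (250 : ℂ) • R ^ 2 - (691 : ℂ) • 1)) :
    D (D t) = (65 / 756 : ℂ) • D (D s₁₁) +
      (25 * 691 / (36 * 756) : ℂ) • D s₃ + (11 * 691 / (36 * 756) : ℂ) • D s₉ -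
      (55 * 691 / 1134 : ℂ) • ((5 : ℂ) • (D s₃ * s₉) + (-2 : ℂ) • (s₃ * D s₉)) -
      (13 * 691 / 9 : ℂ) • (D s₅ * D s₅) := by
  subst ht h₃ h₅ h₉ h₁₁
  simp only [Derivation.map_smul, Derivation.map_sub, Derivation.map_add,
    Derivation.map_one_eq_zero, Derivation.leibniz, pow_succ, pow_zero, one_mul, smul_eq_mul,
    smul_zero, zero_sub, sub_zero, hP, hQ, hR]
  algebra

end RamanujanDerivation

/-! ### Power series in `q` and the Euler derivation -/

section LevelOneQSeries

open UpperHalfPlane hiding I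
open Complex ModularForm EisensteinSeries Derivative MatrixGroups Filter
open scoped Manifold Topology PowerSeries

local notation "𝕢" => Function.Periodic.qParam 1

/-- `F` is the sum of the power series `p` in `q = e ^ (2πiz)` on the upper half-plane. -/
def HasQSeries (F : ℍ → ℂ) (p : ℂ⟦X⟧) : Prop :=
  ∀ z : ℍ, HasSum (fun n : ℕ => p.coeff n * 𝕢 z ^ n) (F z)

/-- The Euler derivation `X d/dX` of formal power series. -/
noncomputable def eulerDerivation : Derivation ℂ ℂ⟦X⟧ ℂ⟦X⟧ :=
  (PowerSeries.X : ℂ⟦X⟧) • PowerSeries.derivative ℂ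

local notation "θ" => eulerDerivation

lemma coeff_eulerDerivation (p : ℂ⟦X⟧) (n : ℕ) : (θ p).coeff n = n * p.coeff n := by
  cases n with
  | zero => simp [eulerDerivation]
  | succ n =>
    simp only [eulerDerivation, Derivation.coe_smul, Pi.smul_apply, smul_eq_mul,
      PowerSeries.coeff_succ_X_mul, PowerSeries.coeff_derivative]
    push_cast
    ring

namespace HasQSeries

variable {F G : ℍ → ℂ} {p r : ℂ⟦X⟧}

lemma sub (hF : HasQSeries F p) (hG : HasQSeries G r) : HasQSeries (F - G) (p - r) := fun z => by
  simpa [sub_mul] using (hF z).sub (hG z)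

lemma smul (c : ℂ) (hF : HasQSeries F p) : HasQSeries (c • F) (c • p) := fun z => by
  simpa [mul_assoc] using (hF z).mul_left c

lemma mul (hF : HasQSeries F p) (hG : HasQSeries G r) : HasQSeries (F * G) (p * r) := fun z => by
  have h := (summable_norm_sum_mul_antidiagonal_of_summable_norm
    (hF z).summable.norm (hG z).summable.norm).of_norm.hasSum
  rw [← tsum_mul_tsum_eq_tsum_sum_antidiagonal_of_summable_norm
    (hF z).summable.norm (hG z).summable.norm, (hF z).tsum_eq, (hG z).tsum_eq] at h
  refine h.congr_fun fun n => ?_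
  rw [PowerSeries.coeff_mul, Finset.sum_mul]
  refine Finset.sum_congr rfl fun ij hij => ?_
  rw [← Finset.HasAntidiagonal.mem_antidiagonal.mp hij, pow_add]
  ring

/-- The normalized derivative acts on `q`-series as the Euler derivation. -/
lemma normalizedDeriv (hF : HasQSeries F p) :
    HasQSeries (normalizedDerivOfComplex F) (θ p) := fun z => by
  -- Termwise differentiation: on the half-plane above height `Im z / 2` the series is dominated by
  -- its absolutely convergent value at `w = i Im z / 2`.
  have hy : 0 < (z : ℂ).im / 2 := half_pos z.im_pos
  let w : ℍ := ⟨Complex.I * ((z : ℂ).im / 2 : ℝ), by simpa using hy⟩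
  have hw : (w : ℂ) = Complex.I * ((z : ℂ).im / 2 : ℝ) := rfl
  let U : Set ℂ := {x | (z : ℂ).im / 2 < x.im}
  have hU : IsOpen U := isOpen_lt continuous_const Complex.continuous_im
  have hzU : (z : ℂ) ∈ U := half_lt_self z.im_pos
  have hd : ∀ (n : ℕ) (x : ℂ), HasDerivAt (fun x => p.coeff n * 𝕢 x ^ n)
      (2 * Real.pi * Complex.I * ((n * p.coeff n) * 𝕢 x ^ n)) x := fun n x => by
    have h1 : HasDerivAt (fun x : ℂ => 𝕢 x) (𝕢 x * (2 * Real.pi * Complex.I)) x := by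
      have := ((hasDerivAt_id x).const_mul (2 * Real.pi * Complex.I)).cexp
      simpa [Function.Periodic.qParam] using this
    refine ((h1.fun_pow n).const_mul (p.coeff n)).congr_deriv ?_
    cases n with
    | zero => simp
    | succ n => rw [Nat.add_sub_cancel]; ring
  have hs := Complex.hasSum_deriv_of_summable_norm (hF w).summable.norm
    (F := fun n x => p.coeff n * 𝕢 x ^ n) (U := U)
    (fun n x _ => (hd n x).differentiableAt.differentiableWithinAt) hU
    (fun n x hx => by
      rw [norm_mul, norm_mul, norm_pow, norm_pow]
      gcongr
      rw [Function.Periodic.norm_qParam, Function.Periodic.norm_qParam]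
      have hx' : (w : ℂ).im ≤ x.im := by simpa [hw] using (show (z : ℂ).im / 2 < x.im from hx).le
      have := Real.pi_pos
      refine Real.exp_le_exp.mpr ?_
      simp only [div_one]
      nlinarith) hzU
  have he : (fun x => ∑' n : ℕ, p.coeff n * 𝕢 x ^ n) =ᶠ[𝓝 (z : ℂ)] F ∘ ofComplex := by
    filter_upwards [isOpen_upperHalfPlaneSet.mem_nhds z.im_pos] with x hx
    rw [Function.comp_apply, ofComplex_apply_of_im_pos hx, ← (hF ⟨x, hx⟩).tsum_eq]
  rw [he.deriv_eq] at hs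
  have := hs.mul_left (2 * Real.pi * Complex.I)⁻¹
  refine this.congr_fun fun n => ?_
  rw [(hd n z).deriv, coeff_eulerDerivation]
  have : (Real.pi : ℂ) ≠ 0 := by exact_mod_cast Real.pi_ne_zero
  field_simp

lemma isBoundedAtImInfty (hF : HasQSeries F p) : IsBoundedAtImInfty F :=
  isBoundedAtImInfty_of_hasSum_qExpansion one_pos (c := fun n => p.coeff n) hF

end HasQSeries

/-! ### Level one modular forms from `q`-series -/

lemma ModularForm.hasQSeries {k : ℤ} (f : ModularForm 𝒮ℒ k) :
    HasQSeries f (qExpansion 1 f) := fun z =>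
  _root_.ModularForm.hasSum_qExpansion f one_pos one_mem_strictPeriods_SL z

lemma HasQSeries.qExpansion_eq {k : ℤ} {f : ModularForm 𝒮ℒ k} {p : ℂ⟦X⟧}
    (hf : HasQSeries f p) : qExpansion 1 f = p := by
  ext n
  exact (ModularFormClass.qExpansion_coeff_unique one_pos one_mem_strictPeriods_SL
    (c := fun n => p.coeff n) hf n).symm

/-- A holomorphic slash-invariant function given by a `q`-series is a level one modular form. -/
lemma HasQSeries.exists_modularForm {k : ℤ} {F : ℍ → ℂ} {p : ℂ⟦X⟧} (hF : HasQSeries F p)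
    (hol : MDiff F) (hslash : ∀ γ : SL(2, ℤ), F ∣[k] γ = F) :
    ∃ f : ModularForm 𝒮ℒ k, qExpansion 1 f = p := by
  let f : ModularForm 𝒮ℒ k :=
    { toFun := F
      slash_action_eq' := fun _ ⟨γ, hγ⟩ => hγ ▸ hslash γ
      holo' := hol
      bdd_at_cusps' {c} hc := by
        rw [Subgroup.IsArithmetic.isCusp_iff_isCusp_SL2Z] at hc
        rw [OnePoint.isBoundedAt_iff_forall_SL2Z hc]
        intro γ _
        rw [hslash γ]
        exact hF.isBoundedAtImInfty }
  exact ⟨f, HasQSeries.qExpansion_eq (f := f) hF⟩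

/-- The `q`-series of `E₂`. -/
noncomputable def qSeriesE2 : ℂ⟦X⟧ :=
  PowerSeries.mk fun m => if m = 0 then 1 else -24 * (ArithmeticFunction.sigma 1 m : ℂ)

lemma hasQSeries_E2 : HasQSeries E2 qSeriesE2 := fun z => by
  simpa [qSeriesE2, Function.Periodic.qParam] using hasSum_qExpansion_E2 (z := z)

/-- The Serre derivative maps modular forms of weight `k` to modular forms of weight `k + 2`. -/
lemma exists_modularForm_serreDerivative {k : ℤ} (f : ModularForm 𝒮ℒ k) :
    ∃ g : ModularForm 𝒮ℒ (k + 2),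
      qExpansion 1 g = θ (qExpansion 1 f) - (k * 12⁻¹ : ℂ) • (qSeriesE2 * qExpansion 1 f) := by
  have h := f.hasQSeries.normalizedDeriv.sub ((hasQSeries_E2.mul f.hasQSeries).smul (k * 12⁻¹))
  have he : normalizedDerivOfComplex f - (k * 12⁻¹ : ℂ) • (E2 * ⇑f) = serreDerivative k f := by
    ext z
    simp [mul_assoc]
  rw [he] at h
  exact h.exists_modularForm (serreDerivative_mdifferentiable _ f.holo') fun γ =>
    serreDerivative_slash_invariant f.holo' (f.slash_action_eq' _ ⟨γ, rfl⟩)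

/-- `D2 γ` is the cocycle measuring the failure of `E₂` to be modular; its derivative is needed for
the quadratic part of the anomaly of `D E₂`. -/
lemma normalizedDeriv_D2 (γ : SL(2, ℤ)) (z : ℍ) :
    normalizedDerivOfComplex (D2 γ) z = - ((γ 1 0 : ℂ) / denom γ z) ^ 2 := by
  have hd : HasDerivAt (fun w : ℂ => denom γ w) (γ 1 0 : ℂ) z := by
    simpa using hasDerivAt_denom_zpow (γ : GL (Fin 2) ℝ) 1 z
  have hz := denom_ne_zero (γ : GL (Fin 2) ℝ) z
  have h := (hasDerivAt_const (z : ℂ) (2 * Real.pi * Complex.I * (γ 1 0 : ℂ))).fun_div hd hz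
  have he : D2 γ ∘ ofComplex =ᶠ[𝓝 (z : ℂ)]
      fun w : ℂ => 2 * Real.pi * Complex.I * (γ 1 0 : ℂ) / denom γ w := by
    filter_upwards [isOpen_upperHalfPlaneSet.mem_nhds z.im_pos] with w hw
    rw [Function.comp_apply, ofComplex_apply_of_im_pos hw]
    rfl
  have hpi : (Real.pi : ℂ) ≠ 0 := by exact_mod_cast Real.pi_ne_zero
  rw [normalizedDerivOfComplex, he.deriv_eq, h.deriv]
  field_simp
  ring

lemma mdifferentiable_D2 (γ : SL(2, ℤ)) : MDiff (D2 γ) := by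
  rw [UpperHalfPlane.mdifferentiable_iff]
  have : DifferentiableOn ℂ
      (fun w : ℂ => 2 * Real.pi * Complex.I * (γ 1 0 : ℂ) / denom γ w) upperHalfPlaneSet := by
    intro w hw
    have hd : HasDerivAt (fun w : ℂ => denom γ w) (γ 1 0 : ℂ) w := by
      simpa using hasDerivAt_denom_zpow (γ : GL (Fin 2) ℝ) 1 ⟨w, hw⟩
    exact ((hasDerivAt_const w _).fun_div hd
      (denom_ne_zero (γ : GL (Fin 2) ℝ) ⟨w, hw⟩)).differentiableAt.differentiableWithinAt
  refine this.congr fun w hw => ?_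
  rw [Function.comp_apply, ofComplex_apply_of_im_pos hw]
  rfl

/-- The quasimodular correction `D E₂ - E₂² / 12` transforms like a modular form of weight 4. -/
lemma normalizedDeriv_E2_sub_slash (γ : SL(2, ℤ)) :
    (normalizedDerivOfComplex E2 - (12⁻¹ : ℂ) • (E2 * E2)) ∣[(4 : ℤ)] γ =
      normalizedDerivOfComplex E2 - (12⁻¹ : ℂ) • (E2 * E2) := by
  have h1 := normalizedDerivOfComplex_SL_slash (k := 2) E2_mdifferentiable (γ := γ)
  rw [E2_slash_action, normalizedDerivOfComplex_sub _ _ E2_mdifferentiable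
    ((mdifferentiable_D2 γ).const_smul _), normalizedDerivOfComplex_smul _ _
    (mdifferentiable_D2 γ)] at h1
  have h2 := ModularForm.mul_slash_SL2 2 2 γ E2 E2
  rw [E2_slash_action] at h2
  norm_num at h1 h2
  ext z
  have h1z := congrFun h1 z
  have h2z := congrFun h2 z
  rw [sub_eq_add_neg, SlashAction.add_slash, SlashAction.neg_slash, ModularForm.SL_smul_slash, h2]
  have hpi : (Real.pi : ℂ) ≠ 0 := by exact_mod_cast Real.pi_ne_zero
  have hz := denom_ne_zero (γ : GL (Fin 2) ℝ) z
  simp only [Pi.sub_apply, Pi.add_apply, Pi.neg_apply, Pi.mul_apply, Pi.smul_apply, smul_eq_mul,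
    normalizedDeriv_D2, D2, riemannZeta_two] at h1z h2z ⊢
  -- With `ζ(2) = π²/6`, the terms linear and quadratic in `c / (cz + d)` from `D E₂` and from `E₂²
  -- / 12` cancel.
  rw [← sub_eq_zero] at h1z ⊢
  rw [← neg_eq_zero, ← h1z]
  field_simp
  ring_nf
  simp only [Complex.I_sq]
  ring

lemma exists_modularForm_E2 :
    ∃ g : ModularForm 𝒮ℒ 4, qExpansion 1 g = θ qSeriesE2 - (12⁻¹ : ℂ) • (qSeriesE2 * qSeriesE2) :=
  (hasQSeries_E2.normalizedDeriv.sub ((hasQSeries_E2.mul hasQSeries_E2).smul _)).exists_modularForm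
    ((normalizedDerivOfComplex_mdifferentiable E2_mdifferentiable).sub
      ((E2_mdifferentiable.mul E2_mdifferentiable).const_smul _))
    normalizedDeriv_E2_sub_slash

/-- The generating series `∑ σ_k(n) X ^ n`. -/
noncomputable def sigmaSeries (k : ℕ) : ℂ⟦X⟧ :=
  PowerSeries.mk fun n => (ArithmeticFunction.sigma k n : ℂ)

@[simp]
lemma coeff_sigmaSeries (k n : ℕ) :
    (sigmaSeries k).coeff n = (ArithmeticFunction.sigma k n : ℂ) := by
  simp [sigmaSeries]

/-! ### Eisenstein coefficients and the Sturm bound -/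

lemma qExpansion_E {k : ℕ} (hk : 3 ≤ k) (hk2 : Even k) :
    qExpansion 1 (E hk) = 1 + (-(2 * k / bernoulli k) : ℂ) • sigmaSeries (k - 1) := by
  ext n
  rw [E_qExpansion_coeff hk hk2]
  rcases eq_or_ne n 0 with rfl | hn
  · rw [map_add, map_smul, coeff_sigmaSeries]
    simp
  · simp [PowerSeries.coeff_one, hn]

/-- The Sturm bound applied to `f - g`. Separate weights `a`, `b` allow comparing forms whose
weights are written differently, such as `4 + 2` and `6`. -/
lemma ModularForm.qExpansion_congr_of_coeff_eq {k : ℕ} {a b : ℤ} (f : ModularForm 𝒮ℒ a)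
    (g : ModularForm 𝒮ℒ b) (ha : a = k) (hb : b = k)
    (h : ∀ n ≤ k / 12, (qExpansion 1 f).coeff n = (qExpansion 1 g).coeff n) :
    qExpansion 1 f = qExpansion 1 g := by
  subst ha
  subst hb
  have hs : qExpansion 1 ⇑(f - g) = qExpansion 1 f - qExpansion 1 g := by
    rw [FunLike.coe_sub, ModularForm.qExpansion_sub one_pos one_mem_strictPeriods_SL]
  have h0 : f - g = 0 := by
    refine ModularForm.sturm_bound_levelOne_nat (lt_of_lt_of_le
      (Nat.cast_lt.mpr (Nat.lt_succ_self (k / 12))) ?_)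
    refine PowerSeries.nat_le_order _ _ fun i hi => ?_
    rw [hs, map_sub, h i (Nat.lt_succ_iff.mp hi), sub_self]
  rw [sub_eq_zero.mp h0]

/-- In weight less than 12 a level one form is determined by its constant term. -/
lemma ModularForm.qExpansion_congr_of_weight_lt {k : ℕ} (hk : k < 12) {a b : ℤ}
    (f : ModularForm 𝒮ℒ a) (g : ModularForm 𝒮ℒ b) (ha : a = k) (hb : b = k) (c : ℂ)
    (hf : (qExpansion 1 f).coeff 0 = c) (hg : (qExpansion 1 g).coeff 0 = 1) :
    qExpansion 1 f = c • qExpansion 1 g := by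
  have hs : qExpansion 1 ⇑(c • g) = c • qExpansion 1 g := by
    rw [FunLike.coe_smul, ModularForm.qExpansion_smul one_pos one_mem_strictPeriods_SL]
  rw [← hs]
  refine qExpansion_congr_of_coeff_eq f (c • g) ha hb fun n hn => ?_
  obtain rfl : n = 0 := by omega
  rw [hs, hf, map_smul, hg, smul_eq_mul, mul_one]

-- Ramanujan's differential equations

local notation "P" => qSeriesE2
local notation "Q" => qExpansion 1 E₄
local notation "R" => qExpansion 1 E₆

lemma coeff_zero_eulerDerivation (p : ℂ⟦X⟧) : (θ p).coeff 0 = 0 := by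
  simp [coeff_eulerDerivation]

lemma coeff_zero_qSeriesE2 : (P).coeff 0 = 1 := by simp [qSeriesE2]

lemma coeff_zero_E₄ : (Q).coeff 0 = 1 := E_qExpansion_coeff_zero _ ⟨2, rfl⟩

lemma coeff_zero_E₆ : (R).coeff 0 = 1 := E_qExpansion_coeff_zero _ ⟨3, rfl⟩

lemma PowerSeries.coeff_zero_mul' {A : Type*} [Semiring A] (p r : A⟦X⟧) :
    (p * r).coeff 0 = p.coeff 0 * r.coeff 0 := by
  simp

/-- Ramanujan's differential equation for `E₂`. -/
lemma eulerDerivation_qSeriesE2 : θ P = (12⁻¹ : ℂ) • (P * P - Q) := by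
  obtain ⟨g, hg⟩ := exists_modularForm_E2
  -- `θ` kills constant terms, so the constant term here is that of `-P² / 12`.
  have h := qExpansion_congr_of_weight_lt (k := 4) (by norm_num) g E₄ rfl rfl (-12⁻¹)
    (by rw [hg, map_sub, map_smul, coeff_zero_eulerDerivation, PowerSeries.coeff_zero_mul',
          coeff_zero_qSeriesE2]; simp) coeff_zero_E₄
  rw [hg] at h
  rw [sub_eq_iff_eq_add.mp h]
  module

/-- Ramanujan's differential equation for `E₄`. -/
lemma eulerDerivation_E₄ : θ Q = (3⁻¹ : ℂ) • (P * Q - R) := by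
  obtain ⟨g, hg⟩ := exists_modularForm_serreDerivative E₄
  have h := qExpansion_congr_of_weight_lt (k := 6) (by norm_num) g E₆ rfl rfl (-3⁻¹)
    (by rw [hg, map_sub, map_smul, coeff_zero_eulerDerivation, PowerSeries.coeff_zero_mul',
          coeff_zero_qSeriesE2, coeff_zero_E₄]; norm_num) coeff_zero_E₆
  rw [hg] at h
  rw [sub_eq_iff_eq_add.mp h, show ((4 : ℤ) : ℂ) * 12⁻¹ = 3⁻¹ by norm_num]
  module

/-- Ramanujan's differential equation for `E₆`. -/
lemma eulerDerivation_E₆ : θ R = (2⁻¹ : ℂ) • (P * R - Q * Q) := by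
  obtain ⟨g, hg⟩ := exists_modularForm_serreDerivative E₆
  have hQ : qExpansion 1 ⇑(E₄.mul E₄) = Q * Q :=
    ModularForm.qExpansion_mul one_pos one_mem_strictPeriods_SL E₄ E₄
  have h := qExpansion_congr_of_weight_lt (k := 8) (by norm_num) g (E₄.mul E₄) rfl rfl (-2⁻¹)
    (by rw [hg, map_sub, map_smul, coeff_zero_eulerDerivation, PowerSeries.coeff_zero_mul',
          coeff_zero_qSeriesE2, coeff_zero_E₆]; norm_num)
    (by rw [hQ, PowerSeries.coeff_zero_mul', coeff_zero_E₄, one_mul])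
  rw [hg, hQ] at h
  rw [sub_eq_iff_eq_add.mp h, show ((6 : ℤ) : ℂ) * 12⁻¹ = 2⁻¹ by norm_num]
  module

/-! ### Divisor sums and tau as polynomials in `E₄`, `E₆` -/

lemma bernoulli_eight : bernoulli 8 = -1 / 30 := by decide +kernel
lemma bernoulli_ten : bernoulli 10 = 5 / 66 := by decide +kernel
lemma bernoulli_twelve : bernoulli 12 = -691 / 2730 := by decide +kernel

lemma qExpansion_E₄_eq : Q = 1 + (240 : ℂ) • sigmaSeries 3 := by
  rw [qExpansion_E _ ⟨2, rfl⟩, show bernoulli 4 = -1 / 30 by decide +kernel]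
  norm_num

lemma qExpansion_E₆_eq : R = 1 - (504 : ℂ) • sigmaSeries 5 := by
  rw [qExpansion_E _ ⟨3, rfl⟩, show bernoulli 6 = 1 / 42 by decide +kernel, sub_eq_add_neg]
  norm_num [neg_smul]

/-- `E₄² = E₈`. -/
lemma qExpansion_E₄_sq : Q * Q = 1 + (480 : ℂ) • sigmaSeries 7 := by
  have hQ : qExpansion 1 ⇑(E₄.mul E₄) = Q * Q :=
    ModularForm.qExpansion_mul one_pos one_mem_strictPeriods_SL E₄ E₄
  have h := qExpansion_congr_of_weight_lt (k := 8) (by norm_num) (E₄.mul E₄)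
    (E (by norm_num : 3 ≤ 8)) rfl rfl 1
    (by rw [hQ, PowerSeries.coeff_zero_mul', coeff_zero_E₄, one_mul])
    (E_qExpansion_coeff_zero _ ⟨4, rfl⟩)
  rw [← hQ, h, one_smul, qExpansion_E _ ⟨4, rfl⟩, bernoulli_eight]
  norm_num

/-- `E₄ E₆ = E₁₀`. -/
lemma qExpansion_E₄_mul_E₆ : Q * R = 1 - (264 : ℂ) • sigmaSeries 9 := by
  have hQ : qExpansion 1 ⇑(E₄.mul E₆) = Q * R :=
    ModularForm.qExpansion_mul one_pos one_mem_strictPeriods_SL E₄ E₆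
  have h := qExpansion_congr_of_weight_lt (k := 10) (by norm_num) (E₄.mul E₆)
    (E (by norm_num : 3 ≤ 10)) rfl rfl 1
    (by rw [hQ, PowerSeries.coeff_zero_mul', coeff_zero_E₄, coeff_zero_E₆, one_mul])
    (E_qExpansion_coeff_zero _ ⟨5, rfl⟩)
  rw [← hQ, h, one_smul, qExpansion_E _ ⟨5, rfl⟩, bernoulli_ten, sub_eq_add_neg]
  norm_num [neg_smul]

/-- `E₄³` as a modular form of weight 12. -/
noncomputable def E₄Cube : ModularForm 𝒮ℒ 12 := ModularForm.mcast (by decide) (E₄.pow 3)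

/-- `E₆²` as a modular form of weight 12. -/
noncomputable def E₆Sq : ModularForm 𝒮ℒ 12 := ModularForm.mcast (by decide) (E₆.pow 2)

lemma qExpansion_E₄Cube : qExpansion 1 ⇑E₄Cube = Q ^ 3 :=
  ModularForm.qExpansion_pow one_pos one_mem_strictPeriods_SL E₄ 3

lemma qExpansion_E₆Sq : qExpansion 1 ⇑E₆Sq = R ^ 2 :=
  ModularForm.qExpansion_pow one_pos one_mem_strictPeriods_SL E₆ 2

/-- `441 E₄³ + 250 E₆² = 691 E₁₂`. -/
lemma qExpansion_E₄_cube_add_E₆_sq :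
    (441 : ℂ) • Q ^ 3 + (250 : ℂ) • R ^ 2 = (691 : ℂ) • 1 + (65520 : ℂ) • sigmaSeries 11 := by
  let F : ModularForm 𝒮ℒ 12 := (441 : ℂ) • E₄Cube + (250 : ℂ) • E₆Sq
  let G : ModularForm 𝒮ℒ 12 := (691 : ℂ) • E (by norm_num : 3 ≤ 12)
  have hF : qExpansion 1 ⇑F = (441 : ℂ) • Q ^ 3 + (250 : ℂ) • R ^ 2 := by
    rw [FunLike.coe_add, ModularForm.qExpansion_add one_pos one_mem_strictPeriods_SL,
      FunLike.coe_smul, FunLike.coe_smul,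
      ModularForm.qExpansion_smul one_pos one_mem_strictPeriods_SL,
      ModularForm.qExpansion_smul one_pos one_mem_strictPeriods_SL, qExpansion_E₄Cube,
      qExpansion_E₆Sq]
  have hG : qExpansion 1 ⇑G = (691 : ℂ) • 1 + (65520 : ℂ) • sigmaSeries 11 := by
    simp only [G, FunLike.coe_smul,
      ModularForm.qExpansion_smul one_pos one_mem_strictPeriods_SL]
    rw [qExpansion_E _ ⟨6, rfl⟩, bernoulli_twelve, smul_add, smul_smul]
    norm_num
  rw [← hF, ← hG]
  refine qExpansion_congr_of_coeff_eq (k := 12) F G rfl rfl fun n hn => ?_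
  rw [hF, hG, pow_succ, pow_two, pow_two]
  -- In weight 12 two coefficients suffice: `441 + 250 = 691` and `441 · 720 - 250 · 1008 = 65520`.
  have hn' : n = 0 ∨ n = 1 := by omega
  rcases hn' with rfl | rfl
  · simp only [map_add, map_smul, PowerSeries.coeff_zero_mul', coeff_zero_E₄, coeff_zero_E₆]
    norm_num
  · norm_num [PowerSeries.coeff_mul, Finset.Nat.antidiagonal_succ, E₄_qExpansion_coeff_one,
      E₆_qExpansion_coeff_one, coeff_zero_E₄, coeff_zero_E₆,
      -PowerSeries.coeff_zero_eq_constantCoeff, PowerSeries.coeff_one]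

/-- The generating series of Ramanujan's tau function. -/
noncomputable def tauSeries : ℂ⟦X⟧ := PowerSeries.mk ramanujanTau

lemma tauSeries_eq : tauSeries = (1728⁻¹ : ℂ) • (Q ^ 3 - R ^ 2) := by
  have hF : qExpansion 1 ⇑(E₄Cube - E₆Sq) = Q ^ 3 - R ^ 2 := by
    rw [FunLike.coe_sub, ModularForm.qExpansion_sub one_pos one_mem_strictPeriods_SL,
      qExpansion_E₄Cube, qExpansion_E₆Sq]
  have hD : ModularForm.discriminant = (1728⁻¹ : ℂ) • ⇑(E₄Cube - E₆Sq) := by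
    ext z
    rw [discriminant_eq_E₄_cube_sub_E₆_sq, div_eq_inv_mul]
    rfl
  rw [← hF, ← ModularForm.qExpansion_smul one_pos one_mem_strictPeriods_SL, ← hD]
  ext n
  simp [tauSeries, ramanujanTau]

lemma sigmaSeries_three : sigmaSeries 3 = (240⁻¹ : ℂ) • (Q - 1) := by
  rw [qExpansion_E₄_eq]
  module

lemma sigmaSeries_five : sigmaSeries 5 = (504⁻¹ : ℂ) • (1 - R) := by
  rw [qExpansion_E₆_eq]
  module

lemma sigmaSeries_seven : sigmaSeries 7 = (480⁻¹ : ℂ) • (Q * Q - 1) := by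
  rw [qExpansion_E₄_sq]
  module

lemma sigmaSeries_nine : sigmaSeries 9 = (264⁻¹ : ℂ) • (1 - Q * R) := by
  rw [qExpansion_E₄_mul_E₆]
  module

lemma sigmaSeries_eleven :
    sigmaSeries 11 = (65520⁻¹ : ℂ) • ((441 : ℂ) • Q ^ 3 + (250 : ℂ) • R ^ 2 - (691 : ℂ) • 1) := by
  rw [qExpansion_E₄_cube_add_E₆_sq]
  module

/-! ### The identities for generating series -/

lemma tauSeries_eq_three_five :
    tauSeries = (5 / 12 : ℂ) • θ (sigmaSeries 3) + (7 / 12 : ℂ) • θ (sigmaSeries 5) +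
      (70 : ℂ) • ((-3 : ℂ) • (θ (sigmaSeries 3) * sigmaSeries 5) +
      (2 : ℂ) • (sigmaSeries 3 * θ (sigmaSeries 5))) :=
  derivation_identity_three_five eulerDerivation eulerDerivation_E₄ eulerDerivation_E₆
    tauSeries_eq sigmaSeries_three sigmaSeries_five

lemma tauSeries_eq_three_three :
    tauSeries = θ (θ (sigmaSeries 3)) +
      (60 : ℂ) • ((0 : ℂ) • (θ (θ (sigmaSeries 3)) * sigmaSeries 3) +
      (-5 : ℂ) • (θ (sigmaSeries 3) * θ (sigmaSeries 3)) +
      (4 : ℂ) • (sigmaSeries 3 * θ (θ (sigmaSeries 3)))) :=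
  derivation_identity_three_three eulerDerivation eulerDerivation_qSeriesE2 eulerDerivation_E₄
    eulerDerivation_E₆ tauSeries_eq sigmaSeries_three

lemma eulerDerivation_sq_tauSeries_eq_five_seven :
    θ (θ tauSeries) = (65 / 756 : ℂ) • θ (θ (sigmaSeries 11)) +
      (5 * 691 / (12 * 756) : ℂ) • θ (sigmaSeries 7) +
      (691 / (12 * 108) : ℂ) • θ (sigmaSeries 5) -
      (5 * 691 / 54 : ℂ) • ((-4 : ℂ) • (θ (sigmaSeries 5) * sigmaSeries 7) +
      (3 : ℂ) • (sigmaSeries 5 * θ (sigmaSeries 7))) -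
      (13 * 691 / 9 : ℂ) • (θ (sigmaSeries 5) * θ (sigmaSeries 5)) :=
  derivation_identity_five_seven eulerDerivation eulerDerivation_qSeriesE2 eulerDerivation_E₄
    eulerDerivation_E₆ tauSeries_eq sigmaSeries_five sigmaSeries_seven sigmaSeries_eleven

lemma eulerDerivation_sq_tauSeries_eq_three_seven :
    θ (θ tauSeries) = (65 / 756 : ℂ) • θ (θ (sigmaSeries 11)) +
      (3 * 691 / (8 * 441) : ℂ) • θ (θ (sigmaSeries 3)) +
      (5 * 691 / (24 * 441) : ℂ) • θ (θ (sigmaSeries 7)) +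
      (5 * 691 / 441 : ℂ) • ((36 : ℂ) • (θ (θ (sigmaSeries 3)) * sigmaSeries 7) +
      (-45 : ℂ) • (θ (sigmaSeries 3) * θ (sigmaSeries 7)) +
        (10 : ℂ) • (sigmaSeries 3 * θ (θ (sigmaSeries 7)))) -
      (13 * 691 / 9 : ℂ) • (θ (sigmaSeries 5) * θ (sigmaSeries 5)) :=
  derivation_identity_three_seven eulerDerivation eulerDerivation_qSeriesE2 eulerDerivation_E₄
    eulerDerivation_E₆ tauSeries_eq sigmaSeries_three sigmaSeries_five sigmaSeries_seven
    sigmaSeries_eleven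

lemma eulerDerivation_sq_tauSeries_eq_three_nine :
    θ (θ tauSeries) = (65 / 756 : ℂ) • θ (θ (sigmaSeries 11)) +
      (25 * 691 / (36 * 756) : ℂ) • θ (sigmaSeries 3) +
      (11 * 691 / (36 * 756) : ℂ) • θ (sigmaSeries 9) -
      (55 * 691 / 1134 : ℂ) • ((5 : ℂ) • (θ (sigmaSeries 3) * sigmaSeries 9) +
      (-2 : ℂ) • (sigmaSeries 3 * θ (sigmaSeries 9))) -
      (13 * 691 / 9 : ℂ) • (θ (sigmaSeries 5) * θ (sigmaSeries 5)) :=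
  derivation_identity_three_nine eulerDerivation eulerDerivation_qSeriesE2 eulerDerivation_E₄
    eulerDerivation_E₆ tauSeries_eq sigmaSeries_three sigmaSeries_five sigmaSeries_nine
    sigmaSeries_eleven

/-! ### Convolution sums as coefficients of products -/

lemma PowerSeries.coeff_mul_of_coeff_zero {A : Type*} [Semiring A] {p r : A⟦X⟧}
    (hp : p.coeff 0 = 0) (hr : r.coeff 0 = 0) (n : ℕ) :
    (p * r).coeff n = ∑ m ∈ Finset.Ico 1 n, p.coeff m * r.coeff (n - m) := by
  rw [PowerSeries.coeff_mul, Finset.Nat.sum_antidiagonal_eq_sum_range_succ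
    (fun i j => p.coeff i * r.coeff j) n]
  symm
  refine Finset.sum_subset (fun m hm => ?_) fun m hm hm' => ?_
  · rw [Finset.mem_Ico] at hm
    exact Finset.mem_range.mpr (by omega)
  · rw [Finset.mem_range] at hm
    rw [Finset.mem_Ico] at hm'
    obtain rfl | rfl : m = 0 ∨ m = n := by omega
    · rw [hp, zero_mul]
    · rw [Nat.sub_self, hr, mul_zero]

lemma sigmaConv_eq_sum_coeff (a b n : ℕ) (w : ℕ → ℂ) :
    sigmaConv a b w n =
      ∑ m ∈ Finset.Ico 1 n, w m * ((sigmaSeries a).coeff m * (sigmaSeries b).coeff (n - m)) := by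
  simp [sigmaConv, mul_assoc]

/-- Convolution sums with a weight that is linear in `m` and `n - m`. -/
lemma sigmaConv_linear (a b n : ℕ) {w : ℕ → ℂ} (α β : ℂ)
    (hw : ∀ m : ℕ, w m = α * m + β * (n - m)) :
    sigmaConv a b w n = (α • (θ (sigmaSeries a) * sigmaSeries b) +
      β • (sigmaSeries a * θ (sigmaSeries b))).coeff n := by
  have h0 : ∀ k, (sigmaSeries k).coeff 0 = 0 := by simp
  simp only [map_add, map_smul, smul_eq_mul, PowerSeries.coeff_mul_of_coeff_zero, h0,
    coeff_zero_eulerDerivation, Finset.mul_sum, ← Finset.sum_add_distrib, sigmaConv_eq_sum_coeff]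
  refine Finset.sum_congr rfl fun m hm => ?_
  rw [hw, coeff_eulerDerivation, coeff_eulerDerivation,
    Nat.cast_sub (Finset.mem_Ico.mp hm).2.le]
  ring

/-- Convolution sums with a weight that is quadratic in `m` and `n - m`. -/
lemma sigmaConv_quadratic (a b n : ℕ) {w : ℕ → ℂ} (α β γ : ℂ)
    (hw : ∀ m : ℕ, w m = α * m ^ 2 + β * (m * (n - m)) + γ * (n - m) ^ 2) :
    sigmaConv a b w n = (α • (θ (θ (sigmaSeries a)) * sigmaSeries b) +
      β • (θ (sigmaSeries a) * θ (sigmaSeries b)) +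
      γ • (sigmaSeries a * θ (θ (sigmaSeries b)))).coeff n := by
  have h0 : ∀ k, (sigmaSeries k).coeff 0 = 0 := by simp
  simp only [map_add, map_smul, smul_eq_mul, PowerSeries.coeff_mul_of_coeff_zero, h0,
    coeff_zero_eulerDerivation, Finset.mul_sum, ← Finset.sum_add_distrib, sigmaConv_eq_sum_coeff]
  refine Finset.sum_congr rfl fun m hm => ?_
  simp only [hw, coeff_eulerDerivation, Nat.cast_sub (Finset.mem_Ico.mp hm).2.le]
  ring

end LevelOneQSeries

open ArithmeticFunction in
theorem theorem2p6 (n : ℕ) (hn : 1 ≤ n) :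
    -- (i)
    (ramanujanTau n = 5 / 12 * n * (sigma 3 n : ℂ) + 7 / 12 * n * (sigma 5 n : ℂ)
      + 70 * sigmaConv 3 5 (fun m => 2 * n - 5 * m) n) ∧
    -- (ii)
    (ramanujanTau n = n ^ 2 * (sigma 3 n : ℂ)
      + 60 * sigmaConv 3 3 (fun m => 4 * n ^ 2 - 13 * m * n + 9 * m ^ 2) n) ∧
    -- (iii)
    (ramanujanTau n = 65 / 756 * (sigma 11 n : ℂ)
      + 5 * 691 / (12 * 756 * n) * (sigma 7 n : ℂ)
      + 691 / (12 * 108 * n) * (sigma 5 n : ℂ)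
      - 5 * 691 / (54 * n ^ 2) * sigmaConv 5 7 (fun m => 3 * n - 7 * m) n
      - 13 * 691 / (9 * n ^ 2) * sigmaConv 5 5 (fun m => m * (n - m)) n) ∧
    -- (iv)
    (ramanujanTau n = 65 / 756 * (sigma 11 n : ℂ)
      + 3 * 691 / (8 * 441) * (sigma 3 n : ℂ)
      + 5 * 691 / (24 * 441) * (sigma 7 n : ℂ)
      + 5 * 691 / (441 * n ^ 2) *
        sigmaConv 3 7 (fun m => 91 * m ^ 2 - 65 * m * n + 10 * n ^ 2) n
      - 13 * 691 / (9 * n ^ 2) * sigmaConv 5 5 (fun m => m * (n - m)) n) ∧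
    -- (v)
    (ramanujanTau n = 65 / 756 * (sigma 11 n : ℂ)
      + 25 * 691 / (36 * 756 * n) * (sigma 3 n : ℂ)
      + 11 * 691 / (36 * 756 * n) * (sigma 9 n : ℂ)
      - 55 * 691 / (1134 * n ^ 2) * sigmaConv 3 9 (fun m => 7 * m - 2 * n) n
      - 13 * 691 / (9 * n ^ 2) * sigmaConv 5 5 (fun m => m * (n - m)) n) := by
  have hn0 : (n : ℂ) ≠ 0 := by exact_mod_cast (Nat.pos_of_ne_zero (by omega)).ne'
  have hτ : tauSeries.coeff n = ramanujanTau n := by simp [tauSeries]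
  have h55 : sigmaConv 5 5 (fun m => m * (n - m)) n =
      (eulerDerivation (sigmaSeries 5) * eulerDerivation (sigmaSeries 5)).coeff n := by
    rw [sigmaConv_quadratic 5 5 n 0 1 0 fun m => by ring, zero_smul, zero_smul, one_smul,
      zero_add, add_zero]
  refine ⟨?_, ?_, ?_, ?_, ?_⟩
  · rw [sigmaConv_linear 3 5 n (-3) 2 fun m => by ring]
    have h := congrArg (PowerSeries.coeff n) tauSeries_eq_three_five
    rw [map_add, map_add, map_smul, map_smul, map_smul _ (70 : ℂ), hτ] at h
    simp only [coeff_eulerDerivation, coeff_sigmaSeries, smul_eq_mul] at h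
    linear_combination h
  · rw [sigmaConv_quadratic 3 3 n 0 (-5) 4 fun m => by ring]
    have h := congrArg (PowerSeries.coeff n) tauSeries_eq_three_three
    rw [map_add, map_smul _ (60 : ℂ), hτ] at h
    simp only [coeff_eulerDerivation, coeff_sigmaSeries, smul_eq_mul] at h
    linear_combination h
  · rw [sigmaConv_linear 5 7 n (-4) 3 fun m => by ring, h55]
    have h := congrArg (PowerSeries.coeff n) eulerDerivation_sq_tauSeries_eq_five_seven
    rw [map_sub, map_sub, map_smul _ (5 * 691 / 54 : ℂ), map_smul _ (13 * 691 / 9 : ℂ)] at h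
    generalize PowerSeries.coeff n (eulerDerivation (sigmaSeries 5) *
      eulerDerivation (sigmaSeries 5)) = T at h ⊢
    generalize PowerSeries.coeff n ((-4 : ℂ) • (eulerDerivation (sigmaSeries 5) * sigmaSeries 7) +
      (3 : ℂ) • (sigmaSeries 5 * eulerDerivation (sigmaSeries 7))) = S at h ⊢
    simp only [map_add, map_smul, coeff_eulerDerivation, coeff_sigmaSeries, smul_eq_mul, hτ] at h
    -- The factor below is a common multiple of the numerical denominators that `field_simp` clears;
    -- likewise in (iv) and (v).
    field_simp
    linear_combination 476171136 * h
  · rw [sigmaConv_quadratic 3 7 n 36 (-45) 10 fun m => by ring, h55]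
    have h := congrArg (PowerSeries.coeff n) eulerDerivation_sq_tauSeries_eq_three_seven
    rw [map_sub, map_add, map_smul _ (5 * 691 / 441 : ℂ), map_smul _ (13 * 691 / 9 : ℂ)] at h
    generalize PowerSeries.coeff n (eulerDerivation (sigmaSeries 5) *
      eulerDerivation (sigmaSeries 5)) = T at h ⊢
    generalize PowerSeries.coeff n
      ((36 : ℂ) • (eulerDerivation (eulerDerivation (sigmaSeries 3)) * sigmaSeries 7) +
        (-45 : ℂ) • (eulerDerivation (sigmaSeries 3) * eulerDerivation (sigmaSeries 7)) +
        (10 : ℂ) • (sigmaSeries 3 * eulerDerivation (eulerDerivation (sigmaSeries 7)))) = S at h ⊢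
    simp only [map_add, map_smul, coeff_eulerDerivation, coeff_sigmaSeries, smul_eq_mul, hτ] at h
    field_simp
    linear_combination 576108288 * h
  · rw [sigmaConv_linear 3 9 n 5 (-2) fun m => by ring, h55]
    have h := congrArg (PowerSeries.coeff n) eulerDerivation_sq_tauSeries_eq_three_nine
    rw [map_sub, map_sub, map_smul _ (55 * 691 / 1134 : ℂ), map_smul _ (13 * 691 / 9 : ℂ)] at h
    generalize PowerSeries.coeff n (eulerDerivation (sigmaSeries 5) *
      eulerDerivation (sigmaSeries 5)) = T at h ⊢
    generalize PowerSeries.coeff n ((5 : ℂ) • (eulerDerivation (sigmaSeries 3) * sigmaSeries 9) +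
      (-2 : ℂ) • (sigmaSeries 3 * eulerDerivation (sigmaSeries 9))) = S at h ⊢
    simp only [map_add, map_smul, coeff_eulerDerivation, coeff_sigmaSeries, smul_eq_mul, hτ] at h
    field_simp
    linear_combination 277766496 * h
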